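/- Let $\Gamma$ be a finite bipartite distance-regular graph with vertex set $X$, path-length distance $\partial$, diameter $D\ge 4$, valency $k\ge 3$ and intersection numbers $b_i=|\{z\in X:\partial(y,z)=1,\ \partial(z,w)=i+1\}|$ (for any vertices $y,w$ with $\partial(y,w)=i$). Let $A_i$ be the $i$-th distance matrix of $\Gamma$ (entry $1$ at $(y,z)$ if $\partial(y,z)=i$, and $0$ otherwise), let $A=A_1$ be the adjacency matrix, let $\theta_0>\theta_1>\cdots>\theta_D$ be the distinct eigenvalues of $A$, and put $d=\lfloor D/2\rfloor$. For $n\in\{1,d\}$ define $$\tilde\theta_n=-1-\frac{b_2b_3}{\theta_n^2-b_2}$$ (the denominator is nonzero). Fix $x\in X$. For $0\le i\le D$ let $E_i^*$ be the diagonal matrix whose $(y,y)$ entry is $1$ if $\partial(x,y)=i$ and $0$ otherwise, and let $T=T(x)$ be the subalgebra of $\mathrm{Mat}_X(\mathbb C)$ generated by $A,E_0^*,\dots,E_D^*$. A $T$-module is a subspace $W$ of $\mathbb C^X$ with $BW\subseteq W$ for all $B\in T$. It is irreducible if it is nonzero and contains no $T$-modules other than $0$ and $W$. An isomorphism of $T$-modules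 is a linear bijection that commutes with every $B\in T$. An irreducible $T$-module $W$ is thin if $\dim E_i^*W\le 1$ for $0\le i\le D$, and its endpoint is $\min\{i: 0\le i\le D,\ E_i^*W\neq 0\}$. If $W$ is thin irreducible with endpoint $2$, then $E_2^*W$ is a one-dimensional space of eigenvectors (together with $0$) of $E_2^*A_2E_2^*$; the corresponding eigenvalue is called the local eigenvalue of $W$. Theorem. Choose $n\in\{1,d\}$ if $D$ is odd, and let $n=1$ if $D$ is even. Let $W$ be a thin irreducible $T$-module with endpoint $2$ and local eigenvalue $\tilde\theta_n$, and let $W'$ be an irreducible $T$-module. Then the following are equivalent: (i) $W$ and $W'$ are isomorphic as $T$-modules; (ii) $W'$ is thin with endpoint $2$ and local eigenvalue $\tilde\theta_n$. -/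

import Mathlib

open scoped Matrix

noncomputable section

namespace SimpleGraph

/-- The number of vertices at distance `i` from `y` and at distance `j` from `z`. -/
def sphereCount {X : Type*} [Fintype X] (Γ : SimpleGraph X) (i j : ℕ) (y z : X) : ℕ :=
  (Finset.univ.filter fun w : X => Γ.dist y w = i ∧ Γ.dist w z = j).card

/-- A connected graph is distance-regular if the number of vertices at distance `i` from `y` and
`j` from `z` depends only on `i`, `j` and the distance between `y` and `z`. -/
def IsDistanceRegular {X : Type*} [Fintype X] (Γ : SimpleGraph X) : Prop :=
  Γ.Connected ∧ ∀ (i j : ℕ) (y z y' z' : X), Γ.dist y z = Γ.dist y' z' →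
    Γ.sphereCount i j y z = Γ.sphereCount i j y' z'

open Classical in
/-- The intersection number `p^h_{ij}`: the value of `sphereCount i j` at a pair of vertices at
distance `h` (any such pair gives the same value if the graph is distance-regular). -/
def intersectionNumber {X : Type*} [Fintype X] (Γ : SimpleGraph X) (h i j : ℕ) : ℕ :=
  if H : ∃ q : X × X, Γ.dist q.1 q.2 = h then Γ.sphereCount i j H.choose.1 H.choose.2 else 0

/-- The intersection number `b_i = p^i_{1,i+1}`; in particular `b_0` is the valency. -/
def interB {X : Type*} [Fintype X] (Γ : SimpleGraph X) (i : ℕ) : ℕ :=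
  Γ.intersectionNumber i 1 (i + 1)

/-- The `i`-th distance matrix `A_i`; the adjacency matrix is `A = A_1`. -/
def distMatrix {X : Type*} (Γ : SimpleGraph X) (i : ℕ) : Matrix X X ℂ :=
  Matrix.of fun y z => if Γ.dist y z = i then 1 else 0

/-- The finite set of eigenvalues of `A`. As `A` is real symmetric, they are all real. -/
def eigenvalueFinset {X : Type*} [Fintype X] [DecidableEq X] (Γ : SimpleGraph X) : Finset ℝ :=
  (Matrix.finite_real_spectrum (A := Γ.distMatrix 1)).toFinset

/-- `θ_i`: the distinct eigenvalues of `A` are listed as `θ_0 > θ_1 > ⋯ > θ_D`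
(and `0` beyond the end of the list). -/
def theta {X : Type*} [Fintype X] [DecidableEq X] (Γ : SimpleGraph X) (i : ℕ) : ℝ :=
  (Γ.eigenvalueFinset.sort (· ≥ ·)).getD i 0

/-- `θ̃_i = -1 - b_2 b_3 / (θ_i² - b_2)`. -/
def thetaTilde {X : Type*} [Fintype X] [DecidableEq X] (Γ : SimpleGraph X) (i : ℕ) : ℝ :=
  -1 - (Γ.interB 2 : ℝ) * (Γ.interB 3 : ℝ) / (Γ.theta i ^ 2 - (Γ.interB 2 : ℝ))

/-- The dual idempotent `E*_i` with respect to `x`. -/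
def dualIdempotent {X : Type*} [DecidableEq X] (Γ : SimpleGraph X) (x : X) (i : ℕ) :
    Matrix X X ℂ :=
  Matrix.diagonal fun y => if Γ.dist x y = i then 1 else 0

/-- The subconstituent (Terwilliger) algebra `T(x)`, generated by `A` and the `E*_i`
(those with `i` above the diameter are zero). -/
def subconstituentAlgebra {X : Type*} [Fintype X] [DecidableEq X] (Γ : SimpleGraph X) (x : X) :
    Subalgebra ℂ (Matrix X X ℂ) :=
  Algebra.adjoin ℂ ({Γ.distMatrix 1} ∪ Set.range (Γ.dualIdempotent x))

/-- A `T(x)`-module: a subspace of the standard module `ℂ^X` that is invariant under `T(x)`. -/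
structure TModule {X : Type*} [Fintype X] [DecidableEq X] (Γ : SimpleGraph X) (x : X) where
  carrier : Submodule ℂ (X → ℂ)
  invariant : ∀ B ∈ Γ.subconstituentAlgebra x, ∀ w ∈ carrier, B *ᵥ w ∈ carrier

namespace TModule

/-- `W` is nonzero and contains no `T`-modules other than `0` and `W`. -/
def IsIrreducible {X : Type*} [Fintype X] [DecidableEq X] {Γ : SimpleGraph X} {x : X}
    (W : Γ.TModule x) : Prop :=
  W.carrier ≠ ⊥ ∧
    ∀ W₁ : Γ.TModule x, W₁.carrier ≤ W.carrier → W₁.carrier = ⊥ ∨ W₁.carrier = W.carrier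

/-- `W` and `W'` are isomorphic as `T`-modules. -/
def IsIsomorphic {X : Type*} [Fintype X] [DecidableEq X] {Γ : SimpleGraph X} {x : X}
    (W W' : Γ.TModule x) : Prop :=
  ∃ σ : W.carrier ≃ₗ[ℂ] W'.carrier,
    ∀ (B : Matrix X X ℂ) (hB : B ∈ Γ.subconstituentAlgebra x) (w : W.carrier),
      (σ ⟨B *ᵥ (w : X → ℂ), W.invariant B hB w w.2⟩ : X → ℂ) = B *ᵥ (σ w : X → ℂ)

/-- The subspace `E*_i W`. -/
def subconstituent {X : Type*} [Fintype X] [DecidableEq X] {Γ : SimpleGraph X} {x : X}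
    (W : Γ.TModule x) (i : ℕ) : Submodule ℂ (X → ℂ) :=
  W.carrier.map (Matrix.mulVecLin (Γ.dualIdempotent x i))

/-- `W` is thin: `dim E*_i W ≤ 1` for `0 ≤ i ≤ D`. -/
def IsThin {X : Type*} [Fintype X] [DecidableEq X] {Γ : SimpleGraph X} {x : X}
    (W : Γ.TModule x) : Prop :=
  ∀ i ≤ Γ.diam, Module.finrank ℂ (W.subconstituent i) ≤ 1

/-- The endpoint of `W`: the least `i` with `0 ≤ i ≤ D` and `E*_i W ≠ 0`
(such `i` exist whenever `W ≠ 0` and the graph is connected). -/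
def endpoint {X : Type*} [Fintype X] [DecidableEq X] {Γ : SimpleGraph X} {x : X}
    (W : Γ.TModule x) : ℕ :=
  sInf {i | i ≤ Γ.diam ∧ W.subconstituent i ≠ ⊥}

/-- `E*_2 W` is nonzero and is an eigenspace of `E*_2 A_2 E*_2` with eigenvalue `η`. For a thin
irreducible `W` with endpoint `2`, exactly one `η` satisfies this: the local eigenvalue of `W`. -/
def HasLocalEigenvalue {X : Type*} [Fintype X] [DecidableEq X] {Γ : SimpleGraph X} {x : X}
    (W : Γ.TModule x) (η : ℝ) : Prop :=
  W.subconstituent 2 ≠ ⊥ ∧ ∀ v ∈ W.subconstituent 2,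
    (Γ.dualIdempotent x 2 * Γ.distMatrix 2 * Γ.dualIdempotent x 2) *ᵥ v = (η : ℂ) • v

end TModule

end SimpleGraph

end

/-! A thin irreducible module with endpoint 2 is determined up to isomorphism by its local
eigenvalue `η`. For nonzero `v` in `E*_2 W` put `u_j = E*_{j+2} A_j v`. The three-term recurrence
raises `u_j` to a known multiple of `u_{j+1}`. For lowering, thinness makes `E*_{j+2} A_{j+4} v` a
multiple of a nonzero `u_j`, and since `v` has coordinate sum zero, `E*_{j+2} A_{j+2} v` is one too.
These multiples obey a recursion that starts from `η` and otherwise involves only intersection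
numbers (`HasLadderCoeffs.succ`); a norm identity shows that the ladder stops when a lowering
coefficient is zero.

So the generators of `T` act on the ladders of `v` and `v'` with the same coefficients
(`IsLocalVector.exists_lower_coeff`). The pairs `(u_j, u'_j)` span an invariant subspace of `W × W'`
whose level-2 part is the line through `(v, v')`; by irreducibility it is the graph of an
isomorphism (`isIsomorphic_of_invariant_prod`). Conversely, an isomorphism commutes with every
`E*_i` and `A_2`, so it preserves thinness, endpoint and local eigenvalue. -/

namespace SimpleGraph

/-! ### Distances and parity in bipartite graphs -/

section Distances

variable {X : Type*} {Γ : SimpleGraph X}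

theorem Connected.even_dist_add_dist_add_dist (hc : Γ.Connected) (hbip : Γ.IsBipartite)
    (x y z : X) : Even (Γ.dist x y + Γ.dist y z + Γ.dist x z) := by
  obtain ⟨col⟩ := hbip
  let c : Γ.Coloring Bool := Γ.recolorOfEquiv finTwoEquiv col
  have key : ∀ u w : X, Even (Γ.dist u w) ↔ (c u = true ↔ c w = true) := fun u w => by
    obtain ⟨p, hp⟩ := hc.exists_walk_length_eq_dist u w
    rw [← hp]
    exact c.even_length_iff_congr p
  simp only [Nat.even_add, key]
  tauto

theorem Connected.exists_adj_dist_eq (hc : Γ.Connected) {y z : X} {j : ℕ}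
    (h : Γ.dist y z = j + 1) : ∃ w, Γ.dist y w = 1 ∧ Γ.dist w z = j := by
  obtain ⟨p, hp⟩ := hc.exists_walk_length_eq_dist y z
  rw [h] at hp
  cases p with
  | nil => simp at hp
  | @cons _ w _ hadj q =>
    refine ⟨w, dist_eq_one_iff_adj.2 hadj, ?_⟩
    have h1 := dist_le q
    have h2 := hc.dist_triangle (u := y) (v := w) (w := z)
    rw [dist_eq_one_iff_adj.2 hadj] at h2
    simp at hp
    omega

theorem distMatrix_zero [DecidableEq X] (hc : Γ.Connected) : Γ.distMatrix 0 = 1 := by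
  ext y z
  simp [distMatrix, Matrix.one_apply, hc.dist_eq_zero_iff]

theorem dist_eq_or_eq_of_adj (hc : Γ.Connected) (hbip : Γ.IsBipartite) {x y z : X}
    (h : Γ.dist y z = 1) : Γ.dist x z = Γ.dist x y + 1 ∨ Γ.dist x y = Γ.dist x z + 1 := by
  have t1 := hc.dist_triangle (u := x) (v := y) (w := z)
  have t3 := hc.dist_triangle (u := x) (v := z) (w := y)
  rw [dist_comm (u := z) (v := y)] at t3
  obtain ⟨r, hr⟩ := hc.even_dist_add_dist_add_dist hbip x y z
  omega

end Distances

/-! ### Distance matrices -/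

variable {X : Type*} [Fintype X] {Γ : SimpleGraph X}

theorem distMatrix_mulVec_apply (j : ℕ) (w : X → ℂ) (y : X) :
    (Γ.distMatrix j *ᵥ w) y = ∑ z, if Γ.dist y z = j then w z else 0 := by
  simp [Matrix.mulVec, dotProduct, distMatrix]

theorem distMatrix_one_mul_apply (j : ℕ) (y z : X) :
    (Γ.distMatrix 1 * Γ.distMatrix j) y z = Γ.sphereCount 1 j y z := by
  simp only [Matrix.mul_apply, distMatrix, Matrix.of_apply, sphereCount, Finset.card_filter,
    Nat.cast_sum]
  refine Finset.sum_congr rfl fun w _ => ?_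
  by_cases h1 : Γ.dist y w = 1 <;> by_cases h2 : Γ.dist w z = j <;> simp [h1, h2]

/-- The three-term recurrence for the distance matrices of a bipartite distance-regular graph. -/
theorem IsDistanceRegular.exists_recurrence (hdr : Γ.IsDistanceRegular) (hbip : Γ.IsBipartite) :
    ∃ c b : ℕ → ℂ, (∀ j, c j ≠ 0) ∧ ∀ j,
      Γ.distMatrix 1 * Γ.distMatrix (j + 1) =
        c j • Γ.distMatrix (j + 2) + b j • Γ.distMatrix j := by
  obtain ⟨hc, hreg⟩ := hdr
  -- At a distance that does not occur the constant defaults to 1, so that `c j` is nonzero for all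
  -- `j`, even beyond the diameter.
  have hconst : ∀ i j h : ℕ, ∃ m : ℕ, ((∃ y z, Γ.dist y z = h) → ∃ y z, Γ.dist y z = h ∧
      Γ.sphereCount i j y z = m) ∧ (¬ (∃ y z, Γ.dist y z = h) → m = 1) ∧
      ∀ y z, Γ.dist y z = h → Γ.sphereCount i j y z = m := by
    intro i j h
    by_cases H : ∃ y z, Γ.dist y z = h
    · obtain ⟨y, z, hyz⟩ := H
      exact ⟨Γ.sphereCount i j y z, fun _ => ⟨y, z, hyz, rfl⟩, fun h' => (h' ⟨y, z, hyz⟩).elim,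
        fun y' z' h' => hreg i j _ _ _ _ (h'.trans hyz.symm)⟩
    · exact ⟨1, fun h' => (H h').elim, fun _ => rfl, fun y z h' => (H ⟨y, z, h'⟩).elim⟩
  choose m hm1 hm2 hm3 using hconst
  -- In the usual notation `c j` is `c_{j+2}` and `b j` is `b_j`.
  refine ⟨fun j => m 1 (j + 1) (j + 2), fun j => m 1 (j + 1) j, fun j => ?_, fun j => ?_⟩
  · rw [Nat.cast_ne_zero]
    by_cases H : ∃ y z, Γ.dist y z = j + 2
    · obtain ⟨y, z, hyz, hs⟩ := hm1 1 (j + 1) (j + 2) H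
      rw [← hs, sphereCount, Finset.card_ne_zero]
      obtain ⟨w, hw⟩ := hc.exists_adj_dist_eq hyz
      exact ⟨w, by simpa using hw⟩
    · rw [hm2 _ _ _ H]
      exact one_ne_zero
  · ext y z
    rw [distMatrix_one_mul_apply]
    simp only [Matrix.add_apply, Matrix.smul_apply, distMatrix, Matrix.of_apply, smul_eq_mul]
    by_cases h2 : Γ.dist y z = j + 2
    · simp [h2, hm3 1 (j + 1) (j + 2) y z h2]
    by_cases h0 : Γ.dist y z = j
    · simp [h0, hm3 1 (j + 1) j y z h0]
    simp only [h2, h0, if_false, mul_zero, add_zero, Nat.cast_eq_zero, sphereCount,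
      Finset.card_eq_zero, Finset.filter_eq_empty_iff]
    rintro w - ⟨h3, h4⟩
    have t1 := hc.dist_triangle (u := y) (v := w) (w := z)
    have t2 := hc.dist_triangle (u := w) (v := y) (w := z)
    rw [dist_comm (u := w) (v := y)] at t2
    obtain ⟨r, hr⟩ := hc.even_dist_add_dist_add_dist hbip y w z
    omega

theorem adj_mulVec_distMatrix_mulVec {c b : ℕ → ℂ}
    (hrec : ∀ j, Γ.distMatrix 1 * Γ.distMatrix (j + 1) =
      c j • Γ.distMatrix (j + 2) + b j • Γ.distMatrix j) (j : ℕ) (v : X → ℂ) :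
    Γ.distMatrix 1 *ᵥ Γ.distMatrix (j + 1) *ᵥ v =
      c j • Γ.distMatrix (j + 2) *ᵥ v + b j • Γ.distMatrix j *ᵥ v := by
  rw [Matrix.mulVec_mulVec, hrec, Matrix.add_mulVec, Matrix.smul_mulVec, Matrix.smul_mulVec]

theorem dotProduct_adj_mulVec (u w : X → ℂ) :
    star (Γ.distMatrix 1 *ᵥ u) ⬝ᵥ w = star u ⬝ᵥ Γ.distMatrix 1 *ᵥ w := by
  have : (Γ.distMatrix 1)ᴴ = Γ.distMatrix 1 := by
    ext y z
    simp only [Matrix.conjTranspose_apply, distMatrix, Matrix.of_apply, dist_comm (u := z)]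
    split_ifs <;> simp
  rw [Matrix.star_mulVec, this, Matrix.dotProduct_mulVec]

/-! ### Dual idempotents and levels with respect to the base vertex -/

variable [DecidableEq X] {x : X}

theorem dualIdempotent_mulVec_apply (i : ℕ) (w : X → ℂ) (y : X) :
    (Γ.dualIdempotent x i *ᵥ w) y = if Γ.dist x y = i then w y else 0 := by
  simp [dualIdempotent, Matrix.mulVec_diagonal]

theorem dualIdempotent_mulVec_self (i : ℕ) (w : X → ℂ) :
    Γ.dualIdempotent x i *ᵥ Γ.dualIdempotent x i *ᵥ w = Γ.dualIdempotent x i *ᵥ w := by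
  ext y
  simp only [dualIdempotent_mulVec_apply]
  split_ifs <;> rfl

theorem dualIdempotent_mulVec_of_ne {i j : ℕ} (h : i ≠ j) (w : X → ℂ) :
    Γ.dualIdempotent x i *ᵥ Γ.dualIdempotent x j *ᵥ w = 0 := by
  ext y
  simp only [dualIdempotent_mulVec_apply]
  split_ifs <;> simp_all

theorem dualIdempotent_eq_zero (hc : Γ.Connected) {i : ℕ} (h : Γ.diam < i) :
    Γ.dualIdempotent x i = 0 := by
  have : Nonempty X := ⟨x⟩
  ext y z
  simp only [dualIdempotent, Matrix.diagonal_apply, Matrix.zero_apply]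
  have := dist_le_diam (connected_iff_ediam_ne_top.1 hc) (u := x) (v := y)
  split_ifs <;> first | omega | rfl

/-- `E*_i A_j E*_l` vanishes unless `i, j, l` satisfy the triangle inequalities and have an even
sum. -/
theorem dualIdempotent_mulVec_distMatrix_mulVec_eq_zero (hc : Γ.Connected) (hbip : Γ.IsBipartite)
    {i j l : ℕ} (h : ¬ (i ≤ j + l ∧ j ≤ i + l ∧ l ≤ i + j ∧ Even (i + j + l))) {w : X → ℂ}
    (hw : Γ.dualIdempotent x l *ᵥ w = w) :
    Γ.dualIdempotent x i *ᵥ Γ.distMatrix j *ᵥ w = 0 := by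
  ext y
  rw [dualIdempotent_mulVec_apply, distMatrix_mulVec_apply]
  split_ifs with hy
  swap
  · rfl
  refine Finset.sum_eq_zero fun z _ => ?_
  rw [← hw, dualIdempotent_mulVec_apply]
  split_ifs with h1 h2 <;> try rfl
  exfalso
  apply h
  have t1 := hc.dist_triangle (u := x) (v := y) (w := z)
  have t2 := hc.dist_triangle (u := y) (v := x) (w := z)
  have t3 := hc.dist_triangle (u := x) (v := z) (w := y)
  rw [dist_comm (u := z) (v := y)] at t3
  rw [dist_comm (u := y) (v := x)] at t2
  have := hc.even_dist_add_dist_add_dist hbip x y z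
  rw [hy, h1, h2] at *
  exact ⟨by omega, by omega, by omega, this⟩

theorem dualIdempotent_mulVec_adj_mulVec (hc : Γ.Connected) (hbip : Γ.IsBipartite) (i : ℕ)
    (w : X → ℂ) :
    Γ.dualIdempotent x (i + 1) *ᵥ Γ.distMatrix 1 *ᵥ w =
      Γ.dualIdempotent x (i + 1) *ᵥ Γ.distMatrix 1 *ᵥ Γ.dualIdempotent x i *ᵥ w +
      Γ.dualIdempotent x (i + 1) *ᵥ Γ.distMatrix 1 *ᵥ Γ.dualIdempotent x (i + 2) *ᵥ w := by
  rw [← Matrix.mulVec_add, ← Matrix.mulVec_add]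
  ext y
  simp only [dualIdempotent_mulVec_apply]
  split_ifs with hy
  swap
  · rfl
  simp only [distMatrix_mulVec_apply]
  refine Finset.sum_congr rfl fun z _ => ?_
  simp only [Pi.add_apply, dualIdempotent_mulVec_apply]
  by_cases h : Γ.dist y z = 1
  · rcases dist_eq_or_eq_of_adj (x := x) hc hbip h with h' | h'
    · simp [h', hy, show i + 1 + 1 ≠ i by omega]
    · have : Γ.dist x z = i := by omega
      simp [this]
  · simp [h]

theorem adj_mulVec_of_dualIdempotent_mulVec (hc : Γ.Connected) (hbip : Γ.IsBipartite) {i : ℕ}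
    {w : X → ℂ} (hw : Γ.dualIdempotent x (i + 1) *ᵥ w = w) :
    Γ.distMatrix 1 *ᵥ w = Γ.dualIdempotent x (i + 2) *ᵥ Γ.distMatrix 1 *ᵥ w +
      Γ.dualIdempotent x i *ᵥ Γ.distMatrix 1 *ᵥ w := by
  ext y
  simp only [Pi.add_apply, dualIdempotent_mulVec_apply]
  by_cases h2 : Γ.dist x y = i + 2
  · simp [h2]
  by_cases h0 : Γ.dist x y = i
  · simp [h0]
  simp only [h2, h0, if_false, add_zero, distMatrix_mulVec_apply]
  refine Finset.sum_eq_zero fun z _ => ?_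
  rw [← hw, dualIdempotent_mulVec_apply]
  split_ifs with h h' <;> try rfl
  have := dist_eq_or_eq_of_adj (x := x) hc hbip h
  omega

/-- A vector supported on the second subconstituent and with coordinate sum zero satisfies
`E*_{j+2} (A_j + A_{j+2} + A_{j+4}) v = 0`. -/
theorem dualIdempotent_mulVec_sum_eq_zero (hc : Γ.Connected) (hbip : Γ.IsBipartite)
    {v : X → ℂ} (hv : Γ.dualIdempotent x 2 *ᵥ v = v)
    (h0 : Γ.dualIdempotent x 0 *ᵥ Γ.distMatrix 2 *ᵥ v = 0) (j : ℕ) :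
    Γ.dualIdempotent x (j + 2) *ᵥ Γ.distMatrix j *ᵥ v +
      Γ.dualIdempotent x (j + 2) *ᵥ Γ.distMatrix (j + 2) *ᵥ v +
      Γ.dualIdempotent x (j + 2) *ᵥ Γ.distMatrix (j + 4) *ᵥ v = 0 := by
  -- The coordinate at `x` of `E*_0 A_2 v` is the sum of `v` over level 2.
  have hsum : ∑ z, v z = 0 := by
    have := congrFun h0 x
    rw [dualIdempotent_mulVec_apply, if_pos (by simp), distMatrix_mulVec_apply] at this
    refine Eq.trans (Finset.sum_congr rfl fun z _ => ?_) this
    rw [← hv, dualIdempotent_mulVec_apply]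
    split_ifs <;> rfl
  rw [← Matrix.mulVec_add, ← Matrix.mulVec_add]
  ext y
  rw [dualIdempotent_mulVec_apply]
  split_ifs with hy
  swap
  · rfl
  simp only [Pi.add_apply, distMatrix_mulVec_apply, ← Finset.sum_add_distrib]
  refine Eq.trans (Finset.sum_congr rfl fun z _ => ?_) hsum
  by_cases hz : Γ.dist x z = 2
  swap
  · have : v z = 0 := by rw [← hv, dualIdempotent_mulVec_apply, if_neg hz]
    simp [this]
  have t1 := hc.dist_triangle (u := x) (v := y) (w := z)
  have t2 := hc.dist_triangle (u := y) (v := x) (w := z)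
  have t3 := hc.dist_triangle (u := x) (v := z) (w := y)
  rw [dist_comm (u := z) (v := y)] at t3
  rw [dist_comm (u := y) (v := x)] at t2
  obtain ⟨r, hr⟩ := hc.even_dist_add_dist_add_dist hbip x y z
  -- Parity and the triangle inequality leave three distances, so the three matrices together sum
  -- `v` over its whole support.
  have : Γ.dist y z = j ∨ Γ.dist y z = j + 2 ∨ Γ.dist y z = j + 4 := by omega
  rcases this with h | h | h <;> simp [h]

/-! ### The ladder and its coefficients -/

/-- The properties of a vector spanning `E*_2 W` for a thin irreducible `T(x)`-module `W` with
endpoint `2` and local eigenvalue `η`, on which the structure of `W` depends. -/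
structure IsLocalVector (Γ : SimpleGraph X) (x : X) (η : ℂ) (v : X → ℂ) : Prop where
  ne_zero : v ≠ 0
  support : Γ.dualIdempotent x 2 *ᵥ v = v
  lower_two : Γ.dualIdempotent x 0 *ᵥ Γ.distMatrix 2 *ᵥ v = 0
  lower_one : Γ.dualIdempotent x 1 *ᵥ Γ.distMatrix 1 *ᵥ v = 0
  eigen : Γ.dualIdempotent x 2 *ᵥ Γ.distMatrix 2 *ᵥ v = η • v
  thin : ∀ j, Γ.dualIdempotent x (j + 2) *ᵥ Γ.distMatrix j *ᵥ v ≠ 0 →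
    ∃ γ : ℂ, Γ.dualIdempotent x (j + 2) *ᵥ Γ.distMatrix (j + 4) *ᵥ v =
      γ • Γ.dualIdempotent x (j + 2) *ᵥ Γ.distMatrix j *ᵥ v

/-- The vector `E*_{j+2} A_j v`. -/
noncomputable def ladder (Γ : SimpleGraph X) (x : X) (v : X → ℂ) (j : ℕ) : X → ℂ :=
  Γ.dualIdempotent x (j + 2) *ᵥ Γ.distMatrix j *ᵥ v

theorem ladder_support (v : X → ℂ) (j : ℕ) :
    Γ.dualIdempotent x (j + 2) *ᵥ Γ.ladder x v j = Γ.ladder x v j :=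
  dualIdempotent_mulVec_self _ _

/-- The coefficients in `E*_{j+2} A E*_{j+1} A_{j+1} v = ρ E*_{j+2} A_j v` and
`E*_{j+2} A_{j+4} v = γ E*_{j+2} A_j v`. -/
def HasLadderCoeffs (Γ : SimpleGraph X) (x : X) (v : X → ℂ) (j : ℕ) (ρ γ : ℂ) : Prop :=
  Γ.ladder x v j ≠ 0 ∧
    Γ.dualIdempotent x (j + 2) *ᵥ Γ.distMatrix 1 *ᵥ Γ.dualIdempotent x (j + 1) *ᵥ
      Γ.distMatrix (j + 1) *ᵥ v = ρ • Γ.ladder x v j ∧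
    Γ.dualIdempotent x (j + 2) *ᵥ Γ.distMatrix (j + 4) *ᵥ v = γ • Γ.ladder x v j

theorem ladder_zero (hc : Γ.Connected) {v : X → ℂ} (hv : Γ.dualIdempotent x 2 *ᵥ v = v) :
    Γ.ladder x v 0 = v := by
  rw [ladder, distMatrix_zero hc, Matrix.one_mulVec, hv]

/-- The leading coefficients in the three-term recurrence, including the one for `j = 0`. -/
noncomputable def leadCoeff (c : ℕ → ℂ) : ℕ → ℂ
  | 0 => 1
  | j + 1 => c j

theorem leadCoeff_ne_zero {c : ℕ → ℂ} (h : ∀ j, c j ≠ 0) : ∀ j, leadCoeff c j ≠ 0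
  | 0 => one_ne_zero
  | j + 1 => h j

/-- `A_j v` reaches no level above `j + 2`, so at the top level only the leading term of the
recurrence survives. As the leading coefficient is nonzero, a ladder that vanishes once vanishes
from then on. -/
theorem raise_ladder (hc : Γ.Connected) (hbip : Γ.IsBipartite) {c b : ℕ → ℂ}
    (hrec : ∀ j, Γ.distMatrix 1 * Γ.distMatrix (j + 1) =
      c j • Γ.distMatrix (j + 2) + b j • Γ.distMatrix j)
    {v : X → ℂ} (hv : Γ.dualIdempotent x 2 *ᵥ v = v) (j : ℕ) :
    Γ.dualIdempotent x (j + 3) *ᵥ Γ.distMatrix 1 *ᵥ Γ.ladder x v j =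
      leadCoeff c j • Γ.ladder x v (j + 1) := by
  cases j with
  | zero =>
    rw [ladder_zero hc hv, leadCoeff, one_smul]
    rfl
  | succ j =>
    have h1 := dualIdempotent_mulVec_adj_mulVec (x := x) hc hbip (j + 3)
      (Γ.distMatrix (j + 1) *ᵥ v)
    rw [dualIdempotent_mulVec_distMatrix_mulVec_eq_zero (i := j + 3 + 2) hc hbip (by omega) hv,
      Matrix.mulVec_zero, Matrix.mulVec_zero, add_zero, adj_mulVec_distMatrix_mulVec hrec,
      Matrix.mulVec_add, Matrix.mulVec_smul, Matrix.mulVec_smul,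
      dualIdempotent_mulVec_distMatrix_mulVec_eq_zero (j := j) hc hbip (by omega) hv,
      smul_zero, add_zero] at h1
    exact h1.symm

/-- Level `j + 2` of `A A_{j+1} v`, computed by the neighbouring levels on the left and by the
recurrence on the right. -/
theorem lower_ladder (hc : Γ.Connected) (hbip : Γ.IsBipartite) {c b : ℕ → ℂ}
    (hrec : ∀ j, Γ.distMatrix 1 * Γ.distMatrix (j + 1) =
      c j • Γ.distMatrix (j + 2) + b j • Γ.distMatrix j) (v : X → ℂ) (j : ℕ) :
    Γ.dualIdempotent x (j + 2) *ᵥ Γ.distMatrix 1 *ᵥ Γ.dualIdempotent x (j + 1) *ᵥ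
        Γ.distMatrix (j + 1) *ᵥ v +
      Γ.dualIdempotent x (j + 2) *ᵥ Γ.distMatrix 1 *ᵥ Γ.ladder x v (j + 1) =
      c j • Γ.dualIdempotent x (j + 2) *ᵥ Γ.distMatrix (j + 2) *ᵥ v +
        b j • Γ.ladder x v j := by
  have h1 := dualIdempotent_mulVec_adj_mulVec (x := x) hc hbip (j + 1)
    (Γ.distMatrix (j + 1) *ᵥ v)
  rw [adj_mulVec_distMatrix_mulVec hrec, Matrix.mulVec_add, Matrix.mulVec_smul,
    Matrix.mulVec_smul] at h1
  exact h1.symm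

/-- `A_{j+5} v` has no part at level `j + 1` and `A_{j+6} v` none at level `j + 2`, so one term
survives on each side. This pins down the next `γ`. -/
theorem lower_upper (hc : Γ.Connected) (hbip : Γ.IsBipartite) {c b : ℕ → ℂ}
    (hrec : ∀ j, Γ.distMatrix 1 * Γ.distMatrix (j + 1) =
      c j • Γ.distMatrix (j + 2) + b j • Γ.distMatrix j)
    {v : X → ℂ} (hv : Γ.dualIdempotent x 2 *ᵥ v = v) (j : ℕ) :
    Γ.dualIdempotent x (j + 2) *ᵥ Γ.distMatrix 1 *ᵥ Γ.dualIdempotent x (j + 3) *ᵥ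
        Γ.distMatrix (j + 5) *ᵥ v =
      b (j + 4) • Γ.dualIdempotent x (j + 2) *ᵥ Γ.distMatrix (j + 4) *ᵥ v := by
  have h1 := dualIdempotent_mulVec_adj_mulVec (x := x) hc hbip (j + 1)
    (Γ.distMatrix (j + 5) *ᵥ v)
  rw [dualIdempotent_mulVec_distMatrix_mulVec_eq_zero (i := j + 1) hc hbip (by omega) hv,
    Matrix.mulVec_zero, Matrix.mulVec_zero, zero_add, adj_mulVec_distMatrix_mulVec hrec,
    Matrix.mulVec_add, Matrix.mulVec_smul, Matrix.mulVec_smul,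
    dualIdempotent_mulVec_distMatrix_mulVec_eq_zero (j := j + 4 + 2) hc hbip (by omega) hv,
    smul_zero, zero_add] at h1
  exact h1.symm

theorem dotProduct_dualIdempotent_mulVec (i : ℕ) (u w : X → ℂ) :
    star (Γ.dualIdempotent x i *ᵥ u) ⬝ᵥ w = star u ⬝ᵥ Γ.dualIdempotent x i *ᵥ w := by
  refine Finset.sum_congr rfl fun y _ => ?_
  simp only [Pi.star_apply, dualIdempotent_mulVec_apply]
  split_ifs <;> simp

/-- Raising and lowering are adjoint because `A` is symmetric. With `ξ = 0` this forces the next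
ladder vector to vanish. -/
theorem leadCoeff_mul_dotProduct_ladder (hc : Γ.Connected) (hbip : Γ.IsBipartite) {c b : ℕ → ℂ}
    (hrec : ∀ j, Γ.distMatrix 1 * Γ.distMatrix (j + 1) =
      c j • Γ.distMatrix (j + 2) + b j • Γ.distMatrix j)
    {v : X → ℂ} (hv : Γ.dualIdempotent x 2 *ᵥ v = v) {j : ℕ} {ξ : ℂ}
    (h : Γ.dualIdempotent x (j + 2) *ᵥ Γ.distMatrix 1 *ᵥ Γ.ladder x v (j + 1) =
      ξ • Γ.ladder x v j) :
    star (leadCoeff c j) * (star (Γ.ladder x v (j + 1)) ⬝ᵥ Γ.ladder x v (j + 1)) =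
      ξ * (star (Γ.ladder x v j) ⬝ᵥ Γ.ladder x v j) := by
  rw [← smul_eq_mul, ← smul_dotProduct, ← star_smul, ← raise_ladder hc hbip hrec hv,
    dotProduct_dualIdempotent_mulVec, ladder_support, dotProduct_adj_mulVec,
    ← ladder_support v j, dotProduct_dualIdempotent_mulVec, h, ladder_support,
    dotProduct_smul, smul_eq_mul]

/-- The sum relation gives `E*_{j+2} A_{j+2} v = -(1 + γ) u_j`; substitute this into `lower_ladder`.
-/
theorem HasLadderCoeffs.lower {v : X → ℂ} {j : ℕ} {ρ γ η : ℂ} {c b : ℕ → ℂ}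
    (hc : Γ.Connected) (hbip : Γ.IsBipartite)
    (hrec : ∀ j, Γ.distMatrix 1 * Γ.distMatrix (j + 1) =
      c j • Γ.distMatrix (j + 2) + b j • Γ.distMatrix j)
    (hv : Γ.IsLocalVector x η v) (h : Γ.HasLadderCoeffs x v j ρ γ) :
    Γ.dualIdempotent x (j + 2) *ᵥ Γ.distMatrix 1 *ᵥ Γ.ladder x v (j + 1) =
      (-(c j * (1 + γ)) + b j - ρ) • Γ.ladder x v j := by
  obtain ⟨-, h2, h3⟩ := h
  have h1 := lower_ladder (x := x) hc hbip hrec v j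
  have h4 := dualIdempotent_mulVec_sum_eq_zero hc hbip hv.support hv.lower_two j
  rw [h3, add_assoc, add_comm, add_assoc, add_eq_zero_iff_eq_neg] at h4
  rw [h2, h4] at h1
  rw [← eq_sub_iff_add_eq'] at h1
  rw [h1]
  change _ • -(_ + Γ.ladder x v j) + _ - _ = _
  module

theorem HasLadderCoeffs.succ {v : X → ℂ} {j : ℕ} {ρ γ η : ℂ} {c b : ℕ → ℂ}
    (hc : Γ.Connected) (hbip : Γ.IsBipartite)
    (hrec : ∀ j, Γ.distMatrix 1 * Γ.distMatrix (j + 1) =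
      c j • Γ.distMatrix (j + 2) + b j • Γ.distMatrix j)
    (hv : Γ.IsLocalVector x η v) (h : Γ.HasLadderCoeffs x v j ρ γ)
    (hξ : -(c j * (1 + γ)) + b j - ρ ≠ 0) :
    Γ.HasLadderCoeffs x v (j + 1) (-((1 + γ) * leadCoeff c j))
      (b (j + 4) * γ / (-(c j * (1 + γ)) + b j - ρ)) := by
  have hl := h.lower hc hbip hrec hv
  obtain ⟨h1, h2, h3⟩ := h
  have hne : Γ.ladder x v (j + 1) ≠ 0 := by
    intro h0
    rw [h0, Matrix.mulVec_zero, Matrix.mulVec_zero, eq_comm, smul_eq_zero] at hl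
    exact hl.elim hξ h1
  refine ⟨hne, ?_, ?_⟩
  · have h4 := dualIdempotent_mulVec_sum_eq_zero hc hbip hv.support hv.lower_two j
    rw [h3] at h4
    have h5 : Γ.dualIdempotent x (j + 2) *ᵥ Γ.distMatrix (j + 2) *ᵥ v =
        (-(1 + γ)) • Γ.ladder x v j := by
      rw [← sub_eq_zero, ← h4]
      change _ = Γ.ladder x v j + _ + _
      module
    change Γ.dualIdempotent x (j + 3) *ᵥ Γ.distMatrix 1 *ᵥ Γ.dualIdempotent x (j + 2) *ᵥ
      Γ.distMatrix (j + 2) *ᵥ v = _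
    rw [h5, Matrix.mulVec_smul, Matrix.mulVec_smul, raise_ladder hc hbip hrec hv.support,
      smul_smul, neg_mul]
  -- Thinness only asserts that some `γ'` exists; lowering both sides gives `γ' ξ = b (j + 4) γ`,
  -- which determines it as `ξ ≠ 0`.
  · obtain ⟨γ', hγ'⟩ := hv.thin (j + 1) hne
    change _ = γ' • Γ.ladder x v (j + 1) at hγ'
    have h6 := lower_upper hc hbip hrec hv.support j
    change Γ.dualIdempotent x (j + 3) *ᵥ Γ.distMatrix (j + 5) *ᵥ v = _ at hγ'
    rw [hγ', h3, Matrix.mulVec_smul, Matrix.mulVec_smul, hl, smul_smul, smul_smul] at h6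
    have h7 := smul_left_injective ℂ h1 h6
    change Γ.dualIdempotent x (j + 3) *ᵥ Γ.distMatrix (j + 5) *ᵥ v = _
    rw [hγ', ← h7, mul_div_cancel_right₀ _ hξ]

/-- Here `ρ = 0` because `v` has nothing below level 2, and `γ` comes from `v + η v + E*_2 A_4 v =
0`. -/
theorem IsLocalVector.hasLadderCoeffs_zero {v : X → ℂ} {η : ℂ} (hc : Γ.Connected)
    (hbip : Γ.IsBipartite) (hv : Γ.IsLocalVector x η v) :
    Γ.HasLadderCoeffs x v 0 0 (-(1 + η)) := by
  have h4 := dualIdempotent_mulVec_sum_eq_zero hc hbip hv.support hv.lower_two 0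
  rw [HasLadderCoeffs, ladder_zero hc hv.support]
  refine ⟨hv.ne_zero, ?_, ?_⟩
  · rw [zero_add, zero_add, hv.lower_one, Matrix.mulVec_zero, Matrix.mulVec_zero, zero_smul]
  · change Γ.ladder x v 0 + _ + _ = 0 at h4
    rw [ladder_zero hc hv.support, zero_add, hv.eigen] at h4
    rw [zero_add, ← sub_eq_zero, ← h4]
    module

/-- The action of `E*_{j+2} A` on the ladder depends on the local eigenvalue only. -/
theorem IsLocalVector.exists_lower_coeff {v v' : X → ℂ} {η : ℂ} (hdr : Γ.IsDistanceRegular)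
    (hbip : Γ.IsBipartite) (hv : Γ.IsLocalVector x η v) (hv' : Γ.IsLocalVector x η v') :
    ∃ C ξ : ℕ → ℂ, ∀ u, (u = v ∨ u = v') → ∀ j,
      Γ.distMatrix 1 *ᵥ Γ.ladder x u 0 = C 0 • Γ.ladder x u 1 ∧
      Γ.distMatrix 1 *ᵥ Γ.ladder x u (j + 1) =
        C (j + 1) • Γ.ladder x u (j + 2) + ξ j • Γ.ladder x u j := by
  obtain ⟨c, b, hc0, hrec⟩ := hdr.exists_recurrence hbip
  have hc := hdr.1
  -- The two ladders vanish together, or else share `ρ` and `γ`.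
  have main : ∀ j, (Γ.ladder x v j = 0 ∧ Γ.ladder x v' j = 0) ∨
      ∃ ρ γ, Γ.HasLadderCoeffs x v j ρ γ ∧ Γ.HasLadderCoeffs x v' j ρ γ := by
    have hzero : ∀ {u}, Γ.IsLocalVector x η u → ∀ j, Γ.ladder x u j = 0 →
        Γ.ladder x u (j + 1) = 0 := fun {u} hu j h0 => by
      have := raise_ladder hc hbip hrec hu.support j
      rw [h0, Matrix.mulVec_zero, Matrix.mulVec_zero, eq_comm, smul_eq_zero] at this
      exact this.resolve_left (leadCoeff_ne_zero hc0 j)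
    intro j
    induction j with
    | zero => exact Or.inr ⟨_, _, hv.hasLadderCoeffs_zero hc hbip, hv'.hasLadderCoeffs_zero hc hbip⟩
    | succ j ih =>
      obtain ⟨h, h'⟩ | ⟨ρ, γ, h, h'⟩ := ih
      · exact Or.inl ⟨hzero hv j h, hzero hv' j h'⟩
      -- A zero lowering coefficient ends both ladders at once, by the norm identity.
      by_cases hξ : -(c j * (1 + γ)) + b j - ρ = 0
      · have key : ∀ {u}, Γ.IsLocalVector x η u → Γ.HasLadderCoeffs x u j ρ γ →
            Γ.ladder x u (j + 1) = 0 := fun {u} hu h => by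
          have := leadCoeff_mul_dotProduct_ladder hc hbip hrec hu.support
            (h.lower hc hbip hrec hu)
          rw [hξ, zero_mul, mul_eq_zero, star_eq_zero] at this
          open scoped ComplexOrder in
          exact dotProduct_star_self_eq_zero.1 (this.resolve_left (leadCoeff_ne_zero hc0 j))
        exact Or.inl ⟨key hv h, key hv' h'⟩
      · exact Or.inr ⟨_, _, h.succ hc hbip hrec hv hξ, h'.succ hc hbip hrec hv' hξ⟩
  have lower : ∀ j, ∃ ξ : ℂ, ∀ u, (u = v ∨ u = v') →
      Γ.dualIdempotent x (j + 2) *ᵥ Γ.distMatrix 1 *ᵥ Γ.ladder x u (j + 1) =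
        ξ • Γ.ladder x u j := by
    intro j
    obtain ⟨h, h'⟩ | ⟨ρ, γ, h, h'⟩ := main j
    · have key : ∀ u, (u = v ∨ u = v') → Γ.IsLocalVector x η u ∧ Γ.ladder x u j = 0 := by
        rintro u (rfl | rfl)
        exacts [⟨hv, h⟩, ⟨hv', h'⟩]
      refine ⟨0, fun u hu => ?_⟩
      obtain ⟨hu, h0⟩ := key u hu
      have := raise_ladder hc hbip hrec hu.support j
      rw [h0, Matrix.mulVec_zero, Matrix.mulVec_zero, eq_comm, smul_eq_zero] at this
      rw [this.resolve_left (leadCoeff_ne_zero hc0 j), Matrix.mulVec_zero, Matrix.mulVec_zero,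
        zero_smul]
    · refine ⟨-(c j * (1 + γ)) + b j - ρ, ?_⟩
      rintro u (rfl | rfl)
      exacts [h.lower hc hbip hrec hv, h'.lower hc hbip hrec hv']
  choose ξ hξ using lower
  refine ⟨leadCoeff c, ξ, fun u hu j => ?_⟩
  have hu' : Γ.IsLocalVector x η u := by
    rcases hu with rfl | rfl
    exacts [hv, hv']
  constructor
  · rw [adj_mulVec_of_dualIdempotent_mulVec hc hbip (i := 1) (ladder_support u 0),
      raise_ladder hc hbip hrec hu'.support, ladder_zero hc hu'.support, hu'.lower_one, add_zero]
  · rw [adj_mulVec_of_dualIdempotent_mulVec hc hbip (ladder_support u (j + 1)),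
      raise_ladder hc hbip hrec hu'.support, hξ j u hu]

/-! ### Elements of the subconstituent algebra -/

theorem adj_mem_subconstituentAlgebra : Γ.distMatrix 1 ∈ Γ.subconstituentAlgebra x :=
  Algebra.subset_adjoin (Or.inl rfl)

theorem dualIdempotent_mem_subconstituentAlgebra (i : ℕ) :
    Γ.dualIdempotent x i ∈ Γ.subconstituentAlgebra x :=
  Algebra.subset_adjoin (Or.inr ⟨i, rfl⟩)

/-- Since `c j ≠ 0`, the recurrence can be solved for `A_{j+2}`: each distance matrix is a
polynomial in `A`. -/
theorem IsDistanceRegular.distMatrix_mem_subconstituentAlgebra (hdr : Γ.IsDistanceRegular)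
    (hbip : Γ.IsBipartite) (j : ℕ) : Γ.distMatrix j ∈ Γ.subconstituentAlgebra x := by
  obtain ⟨c, b, hc0, hrec⟩ := hdr.exists_recurrence hbip
  induction j using Nat.strong_induction_on with
  | _ j ih =>
    match j with
    | 0 => exact distMatrix_zero hdr.1 ▸ one_mem _
    | 1 => exact adj_mem_subconstituentAlgebra
    | j + 2 =>
      have h := hrec j
      rw [← sub_eq_iff_eq_add, ← inv_smul_eq_iff₀ (hc0 j)] at h
      rw [← h]
      exact Subalgebra.smul_mem _ (sub_mem (mul_mem adj_mem_subconstituentAlgebra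
        (ih (j + 1) (by omega))) (Subalgebra.smul_mem _ (ih j (by omega)) _)) _

/-! ### Modules: from local vectors to isomorphisms -/

namespace TModule

variable {W W' : Γ.TModule x}

theorem mem_subconstituent {i : ℕ} {v : X → ℂ} :
    v ∈ W.subconstituent i ↔ v ∈ W.carrier ∧ Γ.dualIdempotent x i *ᵥ v = v := by
  constructor
  · rintro ⟨w, hw, rfl⟩
    exact ⟨W.invariant _ (dualIdempotent_mem_subconstituentAlgebra i) w hw,
      dualIdempotent_mulVec_self i w⟩
  · rintro ⟨hv, h⟩
    exact ⟨v, hv, h⟩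

theorem dualIdempotent_mulVec_mem {i : ℕ} {v : X → ℂ} (hv : v ∈ W.carrier) :
    Γ.dualIdempotent x i *ᵥ v ∈ W.subconstituent i :=
  ⟨v, hv, rfl⟩

theorem exists_isLocalVector (hdr : Γ.IsDistanceRegular) (hbip : Γ.IsBipartite)
    (hD : 1 ≤ Γ.diam) (hthin : W.IsThin) (hend : W.endpoint = 2) {η : ℝ}
    (hη : W.HasLocalEigenvalue η) : ∃ v ∈ W.carrier, Γ.IsLocalVector x η v := by
  obtain ⟨v, hv, hv0⟩ := (Submodule.ne_bot_iff _).1 hη.1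
  obtain ⟨hvW, hvs⟩ := mem_subconstituent.1 hv
  have hA : ∀ i j, Γ.dualIdempotent x i *ᵥ Γ.distMatrix j *ᵥ v ∈ W.subconstituent i :=
    fun i j => dualIdempotent_mulVec_mem
      (W.invariant _ (hdr.distMatrix_mem_subconstituentAlgebra hbip j) v hvW)
  have hbot : ∀ i < 2, W.subconstituent i = ⊥ := fun i hi => by
    by_contra h
    have : W.endpoint ≤ i := Nat.sInf_le ⟨by omega, h⟩
    omega
  refine ⟨v, hvW, hv0, hvs, ?_, ?_, ?_, fun j hj => ?_⟩
  · simpa [hbot] using hA 0 2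
  · simpa [hbot] using hA 1 1
  · have := hη.2 v hv
    rwa [← Matrix.mulVec_mulVec, ← Matrix.mulVec_mulVec, hvs] at this
  · have hjD : j + 2 ≤ Γ.diam := by
      by_contra h
      exact hj (by rw [dualIdempotent_eq_zero hdr.1 (by omega), Matrix.zero_mulVec])
    -- Both vectors lie on one line, and the first is nonzero, so their ratio `t / s` is defined.
    obtain ⟨u, hu⟩ := finrank_le_one_iff.1 (hthin (j + 2) hjD)
    obtain ⟨s, hs⟩ := hu ⟨_, hA (j + 2) j⟩
    obtain ⟨t, ht⟩ := hu ⟨_, hA (j + 2) (j + 4)⟩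
    rw [Subtype.ext_iff] at hs ht
    simp only [Submodule.coe_smul] at hs ht
    have hs0 : s ≠ 0 := by
      rintro rfl
      rw [zero_smul] at hs
      exact hj hs.symm
    exact ⟨t / s, by rw [← hs, ← ht, smul_smul, div_mul_cancel₀ _ hs0]⟩

/-- An invariant subspace of the product of two irreducible modules that is nontrivial and meets
neither factor is the graph of an isomorphism; here the last condition is tested on one vector. -/
theorem isIsomorphic_of_invariant_prod (hW : W.IsIrreducible) (hW' : W'.IsIrreducible)
    (N : Submodule ℂ ((X → ℂ) × (X → ℂ)))
    (hN : ∀ B ∈ Γ.subconstituentAlgebra x, ∀ p ∈ N, (B *ᵥ p.1, B *ᵥ p.2) ∈ N)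
    (hle : N ≤ W.carrier.prod W'.carrier) {v v' : X → ℂ} (hv : v ≠ 0) (hv' : v' ≠ 0)
    (hmem : (v, v') ∈ N) (h1 : (v, 0) ∉ N) (h2 : (0, v') ∉ N) : W.IsIsomorphic W' := by
  have hvW := (hle hmem).1
  have hvW' := (hle hmem).2
  -- `K`, `K'` are the intersections of `N` with the factors and `I`, `I'` its projections. By
  -- irreducibility the former are zero and the latter everything, so both projections of `N` are
  -- bijective.
  let K : Γ.TModule x := ⟨N.comap (LinearMap.inl ℂ _ _), fun B hB w hw => by
    simpa using hN B hB _ hw⟩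
  let K' : Γ.TModule x := ⟨N.comap (LinearMap.inr ℂ _ _), fun B hB w hw => by
    simpa using hN B hB _ hw⟩
  let I : Γ.TModule x := ⟨N.map (LinearMap.fst ℂ _ _), by
    rintro B hB _ ⟨p, hp, rfl⟩
    exact ⟨_, hN B hB p hp, rfl⟩⟩
  let I' : Γ.TModule x := ⟨N.map (LinearMap.snd ℂ _ _), by
    rintro B hB _ ⟨p, hp, rfl⟩
    exact ⟨_, hN B hB p hp, rfl⟩⟩
  have hK : K.carrier = ⊥ := (hW.2 K fun w hw => (hle hw).1).resolve_right fun h =>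
    h1 (show v ∈ K.carrier from h ▸ hvW)
  have hK' : K'.carrier = ⊥ := (hW'.2 K' fun w hw => (hle hw).2).resolve_right fun h =>
    h2 (show v' ∈ K'.carrier from h ▸ hvW')
  have hI : I.carrier = W.carrier := by
    refine (hW.2 I ?_).resolve_left fun h => hv ?_
    · rintro _ ⟨p, hp, rfl⟩
      exact (hle hp).1
    · have : v ∈ I.carrier := ⟨_, hmem, rfl⟩
      rwa [h] at this
  have hI' : I'.carrier = W'.carrier := by
    refine (hW'.2 I' ?_).resolve_left fun h => hv' ?_
    · rintro _ ⟨p, hp, rfl⟩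
      exact (hle hp).2
    · have : v' ∈ I'.carrier := ⟨_, hmem, rfl⟩
      rwa [h] at this
  let f : N →ₗ[ℂ] W.carrier :=
    ((LinearMap.fst ℂ (X → ℂ) (X → ℂ)).comp N.subtype).codRestrict _ fun p => (hle p.2).1
  let f' : N →ₗ[ℂ] W'.carrier :=
    ((LinearMap.snd ℂ (X → ℂ) (X → ℂ)).comp N.subtype).codRestrict _ fun p => (hle p.2).2
  have hf : Function.Bijective f := by
    refine ⟨(injective_iff_map_eq_zero f).2 ?_, ?_⟩
    · rintro ⟨⟨w, w'⟩, hp⟩ h0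
      obtain rfl : w = 0 := congrArg Subtype.val h0
      have : w' ∈ K'.carrier := hp
      rw [hK', Submodule.mem_bot] at this
      subst this
      rfl
    · rintro ⟨w, hw⟩
      rw [← hI] at hw
      obtain ⟨p, hp, rfl⟩ := hw
      exact ⟨⟨p, hp⟩, rfl⟩
  have hf' : Function.Bijective f' := by
    refine ⟨(injective_iff_map_eq_zero f').2 ?_, ?_⟩
    · rintro ⟨⟨w, w'⟩, hp⟩ h0
      obtain rfl : w' = 0 := congrArg Subtype.val h0
      have : w ∈ K.carrier := hp
      rw [hK, Submodule.mem_bot] at this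
      subst this
      rfl
    · rintro ⟨w, hw⟩
      rw [← hI'] at hw
      obtain ⟨p, hp, rfl⟩ := hw
      exact ⟨⟨p, hp⟩, rfl⟩
  let e := LinearEquiv.ofBijective f hf
  let e' := LinearEquiv.ofBijective f' hf'
  refine ⟨e.symm.trans e', fun B hB w => ?_⟩
  obtain ⟨p, rfl⟩ := e.surjective w
  have : (⟨B *ᵥ (e p : X → ℂ), W.invariant B hB _ (e p).2⟩ : W.carrier) =
      e ⟨_, hN B hB p p.2⟩ := rfl
  rw [this, LinearEquiv.trans_apply, LinearEquiv.trans_apply, e.symm_apply_apply,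
    e.symm_apply_apply]
  rfl

/-- Thin irreducible modules with endpoint `2` and the same local eigenvalue are isomorphic. -/
theorem isIsomorphic_of_localEigenvalue (hdr : Γ.IsDistanceRegular) (hbip : Γ.IsBipartite)
    (hD : 1 ≤ Γ.diam) {η : ℝ}
    (hW : W.IsIrreducible) (hthin : W.IsThin) (hend : W.endpoint = 2)
    (hη : W.HasLocalEigenvalue η)
    (hW' : W'.IsIrreducible) (hthin' : W'.IsThin) (hend' : W'.endpoint = 2)
    (hη' : W'.HasLocalEigenvalue η) : W.IsIsomorphic W' := by
  obtain ⟨v, hvW, hv⟩ := exists_isLocalVector hdr hbip hD hthin hend hη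
  obtain ⟨v', hvW', hv'⟩ := exists_isLocalVector hdr hbip hD hthin' hend' hη'
  obtain ⟨C, ξ, hA⟩ := hv.exists_lower_coeff hdr hbip hv'
  let p : ℕ → (X → ℂ) × (X → ℂ) := fun j => (Γ.ladder x v j, Γ.ladder x v' j)
  let N := Submodule.span ℂ (Set.range p)
  have hpN : ∀ j, p j ∈ N := fun j => Submodule.subset_span ⟨j, rfl⟩
  let act : Matrix X X ℂ → Module.End ℂ ((X → ℂ) × (X → ℂ)) := fun B =>
    (Matrix.mulVecLin B).prodMap (Matrix.mulVecLin B)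
  have hE : ∀ i j, act (Γ.dualIdempotent x i) (p j) = if i = j + 2 then p j else 0 := by
    intro i j
    split_ifs with h
    · subst h
      exact Prod.ext (ladder_support _ _) (ladder_support _ _)
    · exact Prod.ext (dualIdempotent_mulVec_of_ne h _) (dualIdempotent_mulVec_of_ne h _)
  -- Shared coefficients make the diagonal action of each generator preserve the span of the pairs.
  have hgen : ∀ B ∈ ({Γ.distMatrix 1} ∪ Set.range (Γ.dualIdempotent x) : Set (Matrix X X ℂ)),
      ∀ q ∈ N, act B q ∈ N := by
    intro B hB
    change N ≤ N.comap (act B)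
    rw [Submodule.span_le]
    rintro _ ⟨j, rfl⟩
    change act B (p j) ∈ N
    rcases hB with rfl | ⟨i, rfl⟩
    · cases j with
      | zero =>
        have : act (Γ.distMatrix 1) (p 0) = C 0 • p 1 :=
          Prod.ext (hA v (Or.inl rfl) 0).1 (hA v' (Or.inr rfl) 0).1
        rw [this]
        exact N.smul_mem _ (hpN _)
      | succ j =>
        have : act (Γ.distMatrix 1) (p (j + 1)) = C (j + 1) • p (j + 2) + ξ j • p j :=
          Prod.ext (hA v (Or.inl rfl) j).2 (hA v' (Or.inr rfl) j).2
        rw [this]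
        exact N.add_mem (N.smul_mem _ (hpN _)) (N.smul_mem _ (hpN _))
    · rw [hE]
      split_ifs
      exacts [hpN j, N.zero_mem]
  have hN : ∀ B ∈ Γ.subconstituentAlgebra x, ∀ q ∈ N, (B *ᵥ q.1, B *ᵥ q.2) ∈ N := by
    intro B hB
    induction hB using Algebra.adjoin_induction with
    | mem B hB => exact hgen B hB
    | algebraMap r =>
      intro q hq
      have : (algebraMap ℂ (Matrix X X ℂ) r *ᵥ q.1, algebraMap ℂ (Matrix X X ℂ) r *ᵥ q.2) =
          r • q := by
        simp only [Algebra.algebraMap_eq_smul_one, Matrix.smul_mulVec, Matrix.one_mulVec]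
        rfl
      rw [this]
      exact N.smul_mem r hq
    | add A B _ _ hA hB =>
      intro q hq
      simp only [Matrix.add_mulVec]
      exact N.add_mem (hA q hq) (hB q hq)
    | mul A B _ _ hA hB =>
      intro q hq
      simp only [← Matrix.mulVec_mulVec]
      exact hA _ (hB q hq)
  have hle : N ≤ W.carrier.prod W'.carrier := by
    rw [Submodule.span_le]
    rintro _ ⟨j, rfl⟩
    have key : ∀ {M : Γ.TModule x} {u}, u ∈ M.carrier → Γ.ladder x u j ∈ M.carrier :=
      fun {M u} hu => M.invariant _ (dualIdempotent_mem_subconstituentAlgebra _) _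
        (M.invariant _ (hdr.distMatrix_mem_subconstituentAlgebra hbip _) _ hu)
    exact ⟨key hvW, key hvW'⟩
  have hp0 : p 0 = (v, v') :=
    Prod.ext (ladder_zero hdr.1 hv.support) (ladder_zero hdr.1 hv'.support)
  -- Only `p 0` lies at level 2, so `E*_2 N` is the line through `(v, v')`; this excludes `(v, 0)`
  -- and `(0, v')` from `N`.
  have hN2 : ∀ q ∈ N, ∃ t : ℂ, act (Γ.dualIdempotent x 2) q = t • (v, v') := by
    intro q hq
    have : N ≤ (Submodule.span ℂ {(v, v')}).comap (act (Γ.dualIdempotent x 2)) := by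
      rw [Submodule.span_le]
      rintro _ ⟨j, rfl⟩
      change act _ (p j) ∈ Submodule.span ℂ {(v, v')}
      rw [hE]
      split_ifs with h
      · obtain rfl : j = 0 := by omega
        rw [hp0]
        exact Submodule.mem_span_singleton_self _
      · exact Submodule.zero_mem _
    obtain ⟨t, ht⟩ := Submodule.mem_span_singleton.1 (this hq)
    exact ⟨t, ht.symm⟩
  refine isIsomorphic_of_invariant_prod hW hW' N hN hle hv.ne_zero hv'.ne_zero
    (hp0 ▸ hpN 0) (fun h => ?_) (fun h => ?_)
  · obtain ⟨t, ht⟩ := hN2 _ h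
    have e1 : Γ.dualIdempotent x 2 *ᵥ v = t • v := congrArg Prod.fst ht
    have e2 : Γ.dualIdempotent x 2 *ᵥ 0 = t • v' := congrArg Prod.snd ht
    rw [Matrix.mulVec_zero, eq_comm, smul_eq_zero, or_iff_left hv'.ne_zero] at e2
    rw [hv.support, e2, zero_smul] at e1
    exact hv.ne_zero e1
  · obtain ⟨t, ht⟩ := hN2 _ h
    have e1 : Γ.dualIdempotent x 2 *ᵥ v' = t • v' := congrArg Prod.snd ht
    have e2 : Γ.dualIdempotent x 2 *ᵥ 0 = t • v := congrArg Prod.fst ht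
    rw [Matrix.mulVec_zero, eq_comm, smul_eq_zero, or_iff_left hv.ne_zero] at e2
    rw [hv'.support, e2, zero_smul] at e1
    exact hv'.ne_zero e1

/-! ### Invariants preserved by isomorphism -/

/-- An isomorphism commutes with `E*_i`. Dimensions of subconstituents, and with them thinness and
endpoint, transfer through this identity. -/
theorem subconstituent_eq_map_of_equiv (σ : W.carrier ≃ₗ[ℂ] W'.carrier)
    (hσ : ∀ (B : Matrix X X ℂ) (hB : B ∈ Γ.subconstituentAlgebra x) (w : W.carrier),
      (σ ⟨B *ᵥ (w : X → ℂ), W.invariant B hB w w.2⟩ : X → ℂ) = B *ᵥ (σ w : X → ℂ)) (i : ℕ) :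
    W'.subconstituent i = ((W.subconstituent i).comap W.carrier.subtype).map
      (W'.carrier.subtype ∘ₗ σ.toLinearMap) := by
  have hB := dualIdempotent_mem_subconstituentAlgebra (Γ := Γ) (x := x) i
  ext y
  constructor
  · rintro ⟨w', hw', rfl⟩
    obtain ⟨w, hw⟩ := σ.surjective ⟨w', hw'⟩
    refine ⟨⟨_, W.invariant _ hB w w.2⟩, dualIdempotent_mulVec_mem w.2, ?_⟩
    refine (hσ _ hB w).trans ?_
    rw [hw]
    rfl
  · rintro ⟨w, hw, rfl⟩
    have h := (mem_subconstituent.1 hw).2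
    refine mem_subconstituent.2 ⟨(σ w).2, ?_⟩
    refine (hσ _ hB w).symm.trans ?_
    exact congrArg (fun u => (σ u : X → ℂ)) (Subtype.ext h)

theorem IsIsomorphic.finrank_subconstituent (h : W.IsIsomorphic W') (i : ℕ) :
    Module.finrank ℂ (W'.subconstituent i) = Module.finrank ℂ (W.subconstituent i) := by
  obtain ⟨σ, hσ⟩ := h
  have hle : W.subconstituent i ≤ W.carrier := fun _ hv => (mem_subconstituent.1 hv).1
  rw [subconstituent_eq_map_of_equiv σ hσ, ← (Submodule.comapSubtypeEquivOfLe hle).finrank_eq]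
  have hinj : Function.Injective (W'.carrier.subtype ∘ₗ σ.toLinearMap) :=
    fun _ _ h => σ.injective (Subtype.ext h)
  exact (Submodule.equivMapOfInjective _ hinj _).finrank_eq.symm

theorem IsIsomorphic.hasLocalEigenvalue (h : W.IsIsomorphic W') {η : ℝ}
    (hdr : Γ.IsDistanceRegular) (hbip : Γ.IsBipartite)
    (hη : W.HasLocalEigenvalue η) : W'.HasLocalEigenvalue η := by
  refine ⟨fun h0 => hη.1 ?_, ?_⟩
  · rw [← Submodule.finrank_eq_zero, ← h.finrank_subconstituent, h0, finrank_bot]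
  obtain ⟨σ, hσ⟩ := h
  intro v hv
  rw [subconstituent_eq_map_of_equiv σ hσ] at hv
  obtain ⟨w, hw, rfl⟩ := hv
  have hB : Γ.dualIdempotent x 2 * Γ.distMatrix 2 * Γ.dualIdempotent x 2 ∈
      Γ.subconstituentAlgebra x :=
    mul_mem (mul_mem (dualIdempotent_mem_subconstituentAlgebra 2)
      (hdr.distMatrix_mem_subconstituentAlgebra hbip 2)) (dualIdempotent_mem_subconstituentAlgebra 2)
  refine (hσ _ hB w).symm.trans ?_
  rw [← map_smul]
  exact congrArg (fun u => (σ u : X → ℂ)) (Subtype.ext (hη.2 _ hw))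

theorem IsIsomorphic.endpoint_eq (h : W.IsIsomorphic W') : W'.endpoint = W.endpoint := by
  simp only [endpoint, Ne, ← Submodule.finrank_eq_zero (R := ℂ), h.finrank_subconstituent]

end TModule

end SimpleGraph

theorem mainTheorem11 {X : Type*} [Fintype X] [DecidableEq X] (Γ : SimpleGraph X)
    (hdr : Γ.IsDistanceRegular) (hbip : Γ.IsBipartite)
    (hD : 4 ≤ Γ.diam) (hk : 3 ≤ Γ.interB 0) (x : X)
    (n : ℕ) (hn : n = 1 ∨ (Odd Γ.diam ∧ n = Γ.diam / 2))
    (W : Γ.TModule x) (hW : W.IsIrreducible) (hWthin : W.IsThin) (hWend : W.endpoint = 2)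
    (hWloc : W.HasLocalEigenvalue (Γ.thetaTilde n))
    (W' : Γ.TModule x) (hW' : W'.IsIrreducible) :
    W.IsIsomorphic W' ↔
      W'.IsThin ∧ W'.endpoint = 2 ∧ W'.HasLocalEigenvalue (Γ.thetaTilde n) := by
  constructor
  · intro h
    exact ⟨fun i hi => (h.finrank_subconstituent i).trans_le (hWthin i hi),
      h.endpoint_eq.trans hWend, h.hasLocalEigenvalue hdr hbip hWloc⟩
  · rintro ⟨hthin', hend', hloc'⟩
    exact SimpleGraph.TModule.isIsomorphic_of_localEigenvalue hdr hbip (by omega) hW hWthin hWend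
      hWloc hW' hthin' hend' hloc'
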